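/- Let $n\ge 0$, $A, A_m\in\mathbb R^{n\times n}$, $b,b_m\in\mathbb R^n$, where all eigenvalues of $A_m$ lie inside the open unit disc, and suppose that there are $k_1^*\in\mathbb R^n$ and $k_2^*\in\mathbb R$, $k_2^*\ne 0$, with $$A+b\,k_1^{*T}=A_m,\qquad k_2^*\,b=b_m .$$ Let $\theta_2^a$ be a known constant with $0<\theta_2^a\le 1/|k_2^*|$, let $s=\operatorname{sign}[k_2^*]$ be known, let $\Gamma=\operatorname{diag}\{\Gamma_1,\gamma_2\}$ with $0<\Gamma_1=\Gamma_1^T<2I_n$ and $0<\gamma_2<2$, and let $r(t)$, $t=0,1,2,\dots$, be a bounded real reference input. Let $W_m(z)=(zI-A_m)^{-1}b_m=[w_{m1}(z),\dots,w_{mn}(z)]^T$, and let $w_{mi}(z)[v](t)$ denote the output at time $t$ of $w_{mi}(z)$ driven from rest by the input $v$ (entrywise for a vector input), i.e. the $i$-th component of $\sum_{\tau=0}^{t-1}A_m^{\,t-1-\tau}b_m\,v(\tau)$. Consider any trajectory, with arbitrary initial values $x(0),\hat x(0),x_m(0),\theta_1(0)$ and with $\operatorname{sign}[\theta_2(0)]=s$,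 $|\theta_2(0)|\ge\theta_2^a$, of the closed-loop system consisting of * the plant $x(t+1)=Ax(t)+bu(t)$ and the reference model $x_m(t+1)=A_mx_m(t)+b_mr(t)$; * the a posteriori state estimator $\hat x(t+1)=A_m\hat x(t)+b_m\big(\theta_2(t)u(t)-\theta_1(t)^Tx(t)\big)$; * the control law $u(t)=k_1(t)^Tx(t)+k_2(t)r(t)$ with $k_1(t)=\theta_1(t)/\theta_2(t)$, $k_2(t)=1/\theta_2(t)$; * the estimation signals, with $\theta=[\theta_1^T,\theta_2]^T$ and $\omega=[-x^T,u]^T$, $$\zeta_i(t)=w_{mi}(z)[\omega](t),\quad \xi_i(t)=\theta(t)^T\zeta_i(t)-w_{mi}(z)[\theta^T\omega](t),\quad \epsilon_i(t)=\hat x_i(t)-x_i(t)+\xi_i(t),\quad i=1,\dots,n,$$ and $m(t)=\sqrt{1+\sum_{i=1}^n\zeta_i(t)^T\zeta_i(t)}$; * the projected gradient adaptive law $\theta(t+1)=\theta(t)+g(t)+[0,\dots,0,f_2(t)]^T$, where $$g(t)=[g_1(t)^T,g_2(t)]^T=-\frac{\Gamma\sum_{i=1}^n\epsilon_i(t)\zeta_i(t)}{m^2(t)},$$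 and $f_2(t)=0$ if $s\,(\theta_2(t)+g_2(t))\ge\theta_2^a$, and $f_2(t)=s\,\theta_2^a-\theta_2(t)-g_2(t)$ otherwise. Then $\operatorname{sign}[\theta_2(t)]=s$ and $|\theta_2(t)|\ge\theta_2^a$ for all $t\ge0$ (so the control law is well defined); all closed-loop signals $x,\hat x,x_m,u,\theta_1,\theta_2,k_1,k_2,\zeta_i,\xi_i,\epsilon_i,m$ are bounded; and $$\lim_{t\to\infty}(x(t)-x_m(t))=0 .$$ Moreover, if $\hat x(0)=x_m(0)$, then $\hat x(t)=x_m(t)$ for all $t\ge0$. -/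

import Mathlib

open Matrix Filter Topology

noncomputable section

namespace AdaptiveTracking

/-- All (complex) eigenvalues of the real matrix `M` lie strictly inside the unit circle. -/
def SchurStable {n : ℕ} (M : Matrix (Fin n) (Fin n) ℝ) : Prop :=
  ∀ z ∈ spectrum ℂ (M.map (algebraMap ℝ ℂ)), ‖z‖ < 1

/-- A signal is bounded. On the finite-dimensional spaces used here all norms are equivalent. -/
def BoundedSignal {E : Type*} [Norm E] (v : ℕ → E) : Prop :=
  ∃ C : ℝ, ∀ t, ‖v t‖ ≤ C

/-- `W_m(z)[v](t)` for `W_m(z) = (zI - A_m)⁻¹ b_m = ∑_{k ≥ 0} A_m ^ k b_m z ^ (-k-1)`: the output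
at time `t` of the transfer function `W_m(z)` driven by the scalar signal `v` from rest.
Its `i`-th component is `w_{mi}(z)[v](t)`. -/
def Wm {n : ℕ} (Am : Matrix (Fin n) (Fin n) ℝ) (bm : Fin n → ℝ) (v : ℕ → ℝ) (t : ℕ) :
    Fin n → ℝ :=
  ∑ τ ∈ Finset.range t, v τ • ((Am ^ (t - 1 - τ)) *ᵥ bm)

/-- The index set of the stacked vectors of `ℝⁿ⁺¹`: `n` entries, followed by one more. -/
abbrev Idx (n : ℕ) : Type := Fin n ⊕ Unit

/-- The first block of a stacked vector: `θ₁` for `θ = [θ₁ᵀ, θ₂]ᵀ`. -/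
def fstBlock {n : ℕ} (θ : Idx n → ℝ) : Fin n → ℝ := fun j => θ (Sum.inl j)

/-- The last entry of a stacked vector: `θ₂` for `θ = [θ₁ᵀ, θ₂]ᵀ`. -/
def lastEntry {n : ℕ} (θ : Idx n → ℝ) : ℝ := θ (Sum.inr ())

/-- The regressor `ω(t) = [-x(t)ᵀ, u(t)]ᵀ`. -/
def regressor {n : ℕ} (x : ℕ → Fin n → ℝ) (u : ℕ → ℝ) (t : ℕ) : Idx n → ℝ :=
  Sum.elim (-(x t)) (fun _ => u t)

/-- The filtered regressors `ζᵢ(t) = w_{mi}(z)[ω](t)` (filtered entry by entry). -/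
def zeta {n : ℕ} (Am : Matrix (Fin n) (Fin n) ℝ) (bm : Fin n → ℝ)
    (x : ℕ → Fin n → ℝ) (u : ℕ → ℝ) (i : Fin n) (t : ℕ) : Idx n → ℝ :=
  fun j => Wm Am bm (fun τ => regressor x u τ j) t i

/-- `ξᵢ(t) = θ(t)ᵀ ζᵢ(t) - w_{mi}(z)[θᵀ ω](t)`. -/
def xi {n : ℕ} (Am : Matrix (Fin n) (Fin n) ℝ) (bm : Fin n → ℝ)
    (x : ℕ → Fin n → ℝ) (u : ℕ → ℝ) (θ : ℕ → Idx n → ℝ) (i : Fin n) (t : ℕ) : ℝ :=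
  θ t ⬝ᵥ zeta Am bm x u i t - Wm Am bm (fun τ => θ τ ⬝ᵥ regressor x u τ) t i

/-- The estimation error `εᵢ(t) = e_{xi}(t) + ξᵢ(t)`, where `e_x(t) = x̂(t) - x(t)`. -/
def eps {n : ℕ} (Am : Matrix (Fin n) (Fin n) ℝ) (bm : Fin n → ℝ)
    (x xhat : ℕ → Fin n → ℝ) (u : ℕ → ℝ) (θ : ℕ → Idx n → ℝ) (i : Fin n) (t : ℕ) : ℝ :=
  (xhat t - x t) i + xi Am bm x u θ i t

/-- The normalizing signal `m(t) = √(1 + ∑ᵢ ζᵢ(t)ᵀ ζᵢ(t))`. -/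
def normalizer {n : ℕ} (Am : Matrix (Fin n) (Fin n) ℝ) (bm : Fin n → ℝ)
    (x : ℕ → Fin n → ℝ) (u : ℕ → ℝ) (t : ℕ) : ℝ :=
  Real.sqrt (1 + ∑ i, zeta Am bm x u i t ⬝ᵥ zeta Am bm x u i t)

/-- The gain matrix `Γ = diag{Γ₁, γ₂}`. -/
def gain {n : ℕ} (Γ₁ : Matrix (Fin n) (Fin n) ℝ) (γ₂ : ℝ) : Matrix (Idx n) (Idx n) ℝ :=
  Matrix.fromBlocks Γ₁ 0 0 (Matrix.diagonal fun _ => γ₂)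

/-- The unprojected increment `g(t) = - Γ (∑ᵢ εᵢ(t) ζᵢ(t)) / m(t)²`. -/
def increment {n : ℕ} (Am : Matrix (Fin n) (Fin n) ℝ) (bm : Fin n → ℝ)
    (Γ₁ : Matrix (Fin n) (Fin n) ℝ) (γ₂ : ℝ)
    (x xhat : ℕ → Fin n → ℝ) (u : ℕ → ℝ) (θ : ℕ → Idx n → ℝ) (t : ℕ) : Idx n → ℝ :=
  -((normalizer Am bm x u t ^ 2)⁻¹ •
    (gain Γ₁ γ₂ *ᵥ ∑ i, eps Am bm x xhat u θ i t • zeta Am bm x u i t))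

/-- The projection signal `f₂` at the current value `θ₂` and increment `g₂`, where `s` is the
known sign of `k₂*` and `θ₂ᵃ` the known lower bound of `|θ₂*|`. -/
def proj (s θ₂a θ₂ g₂ : ℝ) : ℝ :=
  if θ₂a ≤ s * (θ₂ + g₂) then 0 else s * θ₂a - θ₂ - g₂

/-- The controller parameter `k₁(t) = θ₁(t) / θ₂(t)`. -/
def ctrlK₁ {n : ℕ} (θ : ℕ → Idx n → ℝ) (t : ℕ) : Fin n → ℝ :=
  (lastEntry (θ t))⁻¹ • fstBlock (θ t)

/-- The controller parameter `k₂(t) = 1 / θ₂(t)`. -/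
def ctrlK₂ {n : ℕ} (θ : ℕ → Idx n → ℝ) (t : ℕ) : ℝ := (lastEntry (θ t))⁻¹

/-- The signals `x, x̂, x_m, u, θ` are a trajectory of the closed loop formed by the plant, the
reference model, and the indirect adaptive controller. The controller uses only `A_m`, `b_m`, its
design gains, the reference input and the prior knowledge `s`, `θ₂ᵃ`. The initial values of `x`,
`x̂`, `x_m` and `θ₁` are arbitrary. -/
structure IsIndirectAdaptiveLoop {n : ℕ} (A : Matrix (Fin n) (Fin n) ℝ) (b : Fin n → ℝ)
    (Am : Matrix (Fin n) (Fin n) ℝ) (bm : Fin n → ℝ) (s θ₂a : ℝ)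
    (Γ₁ : Matrix (Fin n) (Fin n) ℝ) (γ₂ : ℝ) (r : ℕ → ℝ)
    (x xhat xm : ℕ → Fin n → ℝ) (u : ℕ → ℝ) (θ : ℕ → Idx n → ℝ) : Prop where
  plant : ∀ t, x (t + 1) = A *ᵥ x t + u t • b
  model : ∀ t, xm (t + 1) = Am *ᵥ xm t + r t • bm
  estimator : ∀ t, xhat (t + 1) =
    Am *ᵥ xhat t + (lastEntry (θ t) * u t - fstBlock (θ t) ⬝ᵥ x t) • bm
  control : ∀ t, u t = ctrlK₁ θ t ⬝ᵥ x t + ctrlK₂ θ t * r t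
  init_sign : Real.sign (lastEntry (θ 0)) = s
  init_bound : θ₂a ≤ |lastEntry (θ 0)|
  adaptive_law : ∀ t, θ (t + 1) = θ t + increment Am bm Γ₁ γ₂ x xhat u θ t +
    Sum.elim (0 : Fin n → ℝ) (fun _ => proj s θ₂a (lastEntry (θ t))
      (lastEntry (increment Am bm Γ₁ γ₂ x xhat u θ t)))

end AdaptiveTracking

end

/-!
The control law turns the parametrized input `θᵀω` into the reference input, so the estimator state
`x̂` obeys the reference model itself: it is bounded and `x̂ - x_m` decays. All the work goes into the
error `e = x̂ - x`, which satisfies `e(t+1) = A_m e(t) + b_m (θ(t) - θ*)ᵀ ω(t)` with the true parameter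
`θ* = [k₁*ᵀ/k₂*, 1/k₂*]ᵀ`.

Adding the swapping term `ξᵢ` gives the static linear error model `εᵢ = (θ - θ*)ᵀ ζᵢ + ηᵢ`, where `η`
is a transient of `A_m` (`IsIndirectAdaptiveLoop.eps_eq`). For it, `φᵀ Γ⁻¹ φ` with `φ = θ - θ*` is a
Lyapunov function up to a summable perturbation (`lyapunov_step_le`), and the projection does not
increase it (`proj_spec`). Hence `θ` is bounded, `ε/m → 0` and `θ(t+1) - θ(t) → 0`
(`adaptiveLaw_properties`).

No operator-theoretic small gain theorem is needed to close the loop. As the impulse response of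
`W_m` is summable by Gelfand's formula (`SchurStable.summable_norm_pow_mulVec`), `ξ(t)` is at most
`D(t)` times the supremum of `|ω|` over the past, up to a constant factor, where `D(t)` is a
discounted variation of `θ` that vanishes by dominated convergence (`tendsto_discountedVariation`).
The normalizing signal `m` is bounded affinely by the same supremum. So
`|e(t)| ≤ ν(t) (1 + sup_{τ<t} |ω(τ)|)` with `ν → 0` (`exists_tendsto_norm_sub_le`). As `ω` grows at
most linearly with `x`, and `x = x̂ - e`, an elementary recursion (`exists_le_of_le_add_mul`) bounds
`x`; then `ω` is bounded and the same estimate yields `e → 0`.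
-/

namespace AdaptiveTracking

/-! ### Norm estimates for vectors and matrices -/

theorem abs_dotProduct_le {ι : Type*} [Fintype ι] (v w : ι → ℝ) :
    |v ⬝ᵥ w| ≤ Fintype.card ι * (‖v‖ * ‖w‖) := by
  calc |v ⬝ᵥ w| ≤ ∑ i, |v i * w i| := Finset.abs_sum_le_sum_abs _ _
    _ ≤ ∑ _i : ι, ‖v‖ * ‖w‖ := Finset.sum_le_sum fun i _ => by
        rw [abs_mul]
        exact mul_le_mul (norm_le_pi_norm v i) (norm_le_pi_norm w i) (abs_nonneg _) (norm_nonneg _)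
    _ = _ := by simp

theorem norm_sq_le_dotProduct_self {ι : Type*} [Fintype ι] (v : ι → ℝ) : ‖v‖ ^ 2 ≤ v ⬝ᵥ v := by
  have h0 : 0 ≤ v ⬝ᵥ v := Finset.sum_nonneg fun i _ => mul_self_nonneg (v i)
  have h : ‖v‖ ≤ Real.sqrt (v ⬝ᵥ v) := by
    refine (pi_norm_le_iff_of_nonneg (Real.sqrt_nonneg _)).2 fun i => Real.le_sqrt_of_sq_le ?_
    rw [Real.norm_eq_abs, sq_abs, sq]
    exact Finset.single_le_sum (f := fun i => v i * v i) (fun i _ => mul_self_nonneg (v i))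
      (Finset.mem_univ i)
  calc ‖v‖ ^ 2 ≤ Real.sqrt (v ⬝ᵥ v) ^ 2 := by gcongr
    _ = _ := Real.sq_sqrt h0

/-- A positive definite quadratic form is coercive, by compactness of the unit sphere. -/
theorem _root_.Matrix.PosDef.exists_mul_norm_sq_le {ι : Type*} [Fintype ι] {M : Matrix ι ι ℝ}
    (hM : M.PosDef) : ∃ c > 0, ∀ v, c * ‖v‖ ^ 2 ≤ v ⬝ᵥ M *ᵥ v := by
  have hcont : Continuous fun v : ι → ℝ => v ⬝ᵥ M *ᵥ v :=
    continuous_id.dotProduct (Continuous.matrix_mulVec continuous_const continuous_id)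
  obtain ⟨c, hc, h⟩ := (isCompact_sphere (0 : ι → ℝ) 1).exists_forall_le' hcont.continuousOn
    (a := 0) fun v hv => by
      have hv0 : v ≠ 0 := by rintro rfl; simp at hv
      simpa using hM.dotProduct_mulVec_pos hv0
  refine ⟨c, hc, fun v => ?_⟩
  rcases eq_or_ne v 0 with rfl | hv
  · simp
  have hn : ‖v‖ ≠ 0 := norm_ne_zero_iff.2 hv
  have := h (‖v‖⁻¹ • v) (by simp [norm_smul, hn])
  rw [mulVec_smul, dotProduct_smul, smul_dotProduct, smul_eq_mul, smul_eq_mul] at this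
  calc c * ‖v‖ ^ 2 ≤ (‖v‖⁻¹ * (‖v‖⁻¹ * (v ⬝ᵥ M *ᵥ v))) * ‖v‖ ^ 2 := by gcongr
    _ = _ := by field_simp

/-- If `M < 2 I` then `M ≤ l I` for some `l < 2`. -/
theorem exists_lt_two_dotProduct_mulVec_le {ι : Type*} [Fintype ι] [DecidableEq ι]
    {M : Matrix ι ι ℝ} (hM : ((2 : ℝ) • (1 : Matrix ι ι ℝ) - M).PosDef) :
    ∃ l < 2, ∀ v, v ⬝ᵥ M *ᵥ v ≤ l * (v ⬝ᵥ v) := by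
  obtain ⟨c, hc, h⟩ := hM.exists_mul_norm_sq_le
  have hN : (0 : ℝ) < Fintype.card ι + 1 := by positivity
  refine ⟨2 - c / (Fintype.card ι + 1), by linarith [div_pos hc hN], fun v => ?_⟩
  have h1 := h v
  rw [sub_mulVec, smul_mulVec, one_mulVec, dotProduct_sub, dotProduct_smul, smul_eq_mul] at h1
  have h2 : v ⬝ᵥ v ≤ (Fintype.card ι + 1) * ‖v‖ ^ 2 := by
    nlinarith [le_abs_self (v ⬝ᵥ v), abs_dotProduct_le v v, sq_nonneg ‖v‖]
  have h3 : c / (Fintype.card ι + 1) * (v ⬝ᵥ v) ≤ c * ‖v‖ ^ 2 := by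
    calc _ ≤ c / (Fintype.card ι + 1) * ((Fintype.card ι + 1) * ‖v‖ ^ 2) := by gcongr
      _ = _ := by field_simp
  linarith

/-! ### Powers of a Schur stable matrix -/

/-- By Gelfand's formula, the powers of an element of spectral radius less than one are
summable. -/
theorem summable_norm_pow_of_spectralRadius_lt_one {R : Type*} [NormedRing R]
    [NormedAlgebra ℂ R] [CompleteSpace R] {a : R} (ha : spectralRadius ℂ a < 1) :
    Summable fun k => ‖a ^ k‖ := by
  obtain ⟨q, hq, hq1⟩ := ENNReal.lt_iff_exists_nnreal_btwn.1 ha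
  have hq1' : (q : ℝ) < 1 := by exact_mod_cast hq1
  refine Summable.of_norm_bounded_eventually_nat (g := fun k => (q : ℝ) ^ k)
    (summable_geometric_of_lt_one q.2 hq1') ?_
  filter_upwards [(spectrum.pow_nnnorm_pow_one_div_tendsto_nhds_spectralRadius a).eventually_lt_const
    hq, eventually_gt_atTop 0] with k hk hk0
  have hk0' : (0 : ℝ) < k := by exact_mod_cast hk0
  have h := ENNReal.rpow_le_rpow hk.le hk0'.le
  rw [← ENNReal.rpow_mul, one_div, inv_mul_cancel₀ hk0'.ne', ENNReal.rpow_one,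
    ENNReal.rpow_natCast] at h
  rw [norm_norm]
  exact_mod_cast h

theorem SchurStable.summable_norm_pow_mulVec {n : ℕ} {M : Matrix (Fin n) (Fin n) ℝ}
    (hM : SchurStable M) (v : Fin n → ℝ) : Summable fun k => ‖(M ^ k) *ᵥ v‖ := by
  rcases Nat.eq_zero_or_pos n with rfl | hn
  · simpa only [norm_of_subsingleton] using summable_zero
  have : Nonempty (Fin n) := ⟨⟨0, hn⟩⟩
  let : NormedRing (Matrix (Fin n) (Fin n) ℂ) := Matrix.linftyOpNormedRing
  let : NormedAlgebra ℂ (Matrix (Fin n) (Fin n) ℂ) := Matrix.linftyOpNormedAlgebra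
  have : CompleteSpace (Matrix (Fin n) (Fin n) ℂ) := FiniteDimensional.complete ℂ _
  have hr : spectralRadius ℂ (M.map (algebraMap ℝ ℂ)) < 1 :=
    spectrum.spectralRadius_lt_of_forall_lt (r := 1) _ fun z hz => hM z hz
  refine Summable.of_nonneg_of_le (fun _ => norm_nonneg _) (fun k => ?_)
    ((summable_norm_pow_of_spectralRadius_lt_one hr).mul_right ‖fun i => (v i : ℂ)‖)
  have h : (fun i => (((M ^ k) *ᵥ v) i : ℂ)) =
      (M.map (algebraMap ℝ ℂ) ^ k) *ᵥ fun i => (v i : ℂ) := by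
    rw [← Matrix.map_pow]
    ext i
    simp [mulVec, dotProduct]
  calc ‖(M ^ k) *ᵥ v‖ = ‖fun i => (((M ^ k) *ᵥ v) i : ℂ)‖ := by
        simp only [Pi.norm_def, Complex.nnnorm_real]
    _ ≤ _ := h ▸ Matrix.linfty_opNorm_mulVec _ _

/-! ### Scalar sequences -/

/-- A Lyapunov argument: a nonnegative sequence that decreases by `E t` up to a summable
perturbation is bounded, and the decrements are summable. -/
theorem bounded_and_summable_of_add_le {V E h : ℕ → ℝ} (hV : ∀ t, 0 ≤ V t) (hE : ∀ t, 0 ≤ E t)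
    (hh : ∀ t, 0 ≤ h t) (hs : Summable h) (hle : ∀ t, V (t + 1) + E t ≤ V t + h t) :
    (∃ C, ∀ t, V t ≤ C) ∧ Summable E := by
  have key : ∀ t, V t + ∑ k ∈ Finset.range t, E k ≤ V 0 + ∑' k, h k := by
    intro t
    refine le_trans ?_ (add_le_add_right (hs.sum_le_tsum (Finset.range t) fun k _ => hh k) _)
    induction t with
    | zero => simp
    | succ t ih =>
      rw [Finset.sum_range_succ, Finset.sum_range_succ]
      linarith [hle t]
  refine ⟨⟨_, fun t => le_trans ?_ (key t)⟩,
    summable_of_sum_range_le hE fun t => le_trans ?_ (key t)⟩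
  · linarith [Finset.sum_nonneg fun k (_ : k ∈ Finset.range t) => hE k]
  · linarith [hV t]

/-- A small gain lemma: a sequence is bounded if each term is bounded by a constant plus an
asymptotically vanishing multiple of the largest preceding term. -/
theorem exists_le_of_le_add_mul {y ν : ℕ → ℝ} {B : ℝ} (hν : Tendsto ν atTop (𝓝 0))
    (h : ∀ t M, 0 ≤ M → (∀ τ < t, y τ ≤ M) → y t ≤ B + ν t * (1 + M)) :
    ∃ C, ∀ t, y t ≤ C := by
  obtain ⟨T, hT⟩ := eventually_atTop.1 (hν.eventually_le_const (by norm_num : (0 : ℝ) < 1 / 2))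
  have hS : 0 ≤ ∑ τ ∈ Finset.range T, |y τ| := Finset.sum_nonneg fun _ _ => abs_nonneg _
  -- `C` dominates the terms before `T`, and `B + (1 + C) / 2 ≤ C` propagates the bound beyond `T`.
  set C := ∑ τ ∈ Finset.range T, |y τ| + (2 * |B| + 1) with hC
  have hC0 : 0 ≤ C := by positivity
  refine ⟨C, fun t => ?_⟩
  induction t using Nat.strong_induction_on with
  | _ t ih =>
    rcases lt_or_ge t T with ht | ht
    · have := Finset.single_le_sum (f := fun τ => |y τ|) (fun _ _ => abs_nonneg _)
        (Finset.mem_range.2 ht)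
      linarith [le_abs_self (y t), abs_nonneg B]
    · have h1 := h t C hC0 ih
      have h2 : ν t * (1 + C) ≤ 1 / 2 * (1 + C) :=
        mul_le_mul_of_nonneg_right (hT t ht) (by linarith)
      linarith [le_abs_self B]

section Stacked

variable {n : ℕ}

/-! ### Stacked vectors and the gain matrix -/

theorem dotProduct_eq_blocks (v w : Idx n → ℝ) :
    v ⬝ᵥ w = fstBlock v ⬝ᵥ fstBlock w + lastEntry v * lastEntry w := by
  simp [dotProduct, fstBlock, lastEntry, Fintype.sum_sum_type]

theorem fstBlock_gain_mulVec (Γ₁ : Matrix (Fin n) (Fin n) ℝ) (γ₂ : ℝ) (p : Idx n → ℝ) :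
    fstBlock (gain Γ₁ γ₂ *ᵥ p) = Γ₁ *ᵥ fstBlock p := by
  ext i
  simp [fstBlock, gain, mulVec, dotProduct, Fintype.sum_sum_type]

theorem lastEntry_gain_mulVec (Γ₁ : Matrix (Fin n) (Fin n) ℝ) (γ₂ : ℝ) (p : Idx n → ℝ) :
    lastEntry (gain Γ₁ γ₂ *ᵥ p) = γ₂ * lastEntry p := by
  simp [lastEntry, gain, mulVec, dotProduct, Fintype.sum_sum_type]

/-! ### The Lyapunov function of the parameter error -/

/-- The quadratic form `φᵀ Γ⁻¹ φ` for `Γ = diag{Γ₁, γ₂}`, written blockwise. -/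
noncomputable def lyapunov (Γ₁ : Matrix (Fin n) (Fin n) ℝ) (γ₂ : ℝ) (φ : Idx n → ℝ) : ℝ :=
  fstBlock φ ⬝ᵥ Γ₁⁻¹ *ᵥ fstBlock φ + lastEntry φ ^ 2 / γ₂

theorem exists_mul_sq_le_lyapunov {Γ₁ : Matrix (Fin n) (Fin n) ℝ} (hΓ₁ : Γ₁.PosDef) {γ₂ : ℝ}
    (hγ₂ : 0 < γ₂) : ∃ c > 0, ∀ φ j, c * φ j ^ 2 ≤ lyapunov Γ₁ γ₂ φ := by
  obtain ⟨c, hc, h⟩ := hΓ₁.inv.exists_mul_norm_sq_le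
  refine ⟨min c γ₂⁻¹, lt_min hc (inv_pos.2 hγ₂), fun φ j => ?_⟩
  have h1 := h (fstBlock φ)
  have h2 : 0 ≤ lastEntry φ ^ 2 / γ₂ := by positivity
  have h3 : 0 ≤ c * ‖fstBlock φ‖ ^ 2 := by positivity
  rw [lyapunov]
  rcases j with j | j
  · have h4 : φ (Sum.inl j) ^ 2 ≤ ‖fstBlock φ‖ ^ 2 := by
      rw [← sq_abs]
      exact pow_le_pow_left₀ (abs_nonneg _) (norm_le_pi_norm (fstBlock φ) j) 2
    have h5 : min c γ₂⁻¹ * φ (Sum.inl j) ^ 2 ≤ c * ‖fstBlock φ‖ ^ 2 :=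
      mul_le_mul (min_le_left _ _) h4 (sq_nonneg _) hc.le
    linarith
  · have h5 : min c γ₂⁻¹ * lastEntry φ ^ 2 ≤ γ₂⁻¹ * lastEntry φ ^ 2 :=
      mul_le_mul_of_nonneg_right (min_le_right _ _) (sq_nonneg _)
    rw [div_eq_inv_mul]
    change min c γ₂⁻¹ * lastEntry φ ^ 2 ≤ _
    linarith

theorem lyapunov_sub_gain_mulVec {Γ₁ : Matrix (Fin n) (Fin n) ℝ} (hΓ₁ : Γ₁.PosDef) {γ₂ : ℝ}
    (hγ₂ : 0 < γ₂) (φ p : Idx n → ℝ) :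
    lyapunov Γ₁ γ₂ (φ - gain Γ₁ γ₂ *ᵥ p) = lyapunov Γ₁ γ₂ φ - 2 * (φ ⬝ᵥ p) +
      (fstBlock p ⬝ᵥ Γ₁ *ᵥ fstBlock p + γ₂ * lastEntry p ^ 2) := by
  have hu : IsUnit Γ₁.det := (Matrix.isUnit_iff_isUnit_det _).1 hΓ₁.isUnit
  have hsymm : Γ₁ᵀ = Γ₁ := by simpa using hΓ₁.isHermitian.eq
  have e1 : fstBlock (φ - gain Γ₁ γ₂ *ᵥ p) = fstBlock φ - Γ₁ *ᵥ fstBlock p := by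
    rw [← fstBlock_gain_mulVec Γ₁ γ₂]; rfl
  have e2 : lastEntry (φ - gain Γ₁ γ₂ *ᵥ p) = lastEntry φ - γ₂ * lastEntry p := by
    rw [← lastEntry_gain_mulVec Γ₁ γ₂]; rfl
  have e3 : Γ₁⁻¹ *ᵥ (Γ₁ *ᵥ fstBlock p) = fstBlock p := by
    rw [mulVec_mulVec, Matrix.nonsing_inv_mul _ hu, one_mulVec]
  have e4 : (Γ₁ *ᵥ fstBlock p) ⬝ᵥ (Γ₁⁻¹ *ᵥ fstBlock φ) = fstBlock φ ⬝ᵥ fstBlock p := by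
    rw [dotProduct_comm, ← hsymm, mulVec_transpose, dotProduct_comm, ← dotProduct_mulVec,
      hsymm, mulVec_mulVec, Matrix.mul_nonsing_inv _ hu, one_mulVec, dotProduct_comm]
  rw [lyapunov, lyapunov, e1, e2, dotProduct_eq_blocks, mulVec_sub, e3, sub_dotProduct,
    dotProduct_sub, dotProduct_sub, e4, dotProduct_comm (Γ₁ *ᵥ fstBlock p)]
  field_simp
  ring

/-! ### Parameter projection -/

/-- The projection keeps the sign and the lower bound of the estimate, is no larger than the
increment it corrects, and does not increase the distance to any admissible value `a`. -/
theorem proj_spec {s θ₂a a c g : ℝ} (hs : s = 1 ∨ s = -1) (hc : θ₂a ≤ s * c) (ha : θ₂a ≤ s * a) :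
    θ₂a ≤ s * (c + g + proj s θ₂a c g) ∧ |proj s θ₂a c g| ≤ |g| ∧
      (c + g + proj s θ₂a c g - a) ^ 2 ≤ (c + g - a) ^ 2 := by
  unfold proj
  split_ifs with h
  · simpa using h
  · rw [not_le] at h
    rcases hs with rfl | rfl
    · refine ⟨by linarith, ?_, by nlinarith⟩
      rw [abs_of_nonneg (by linarith), abs_of_neg (by linarith)]
      linarith
    · refine ⟨by linarith, ?_, by nlinarith⟩
      rw [abs_of_nonpos (by linarith), abs_of_pos (by linarith)]
      linarith

/-! ### Convergence properties of the adaptive law -/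

/-- The normalized gradient `p = ∑ᵢ εᵢ ζᵢ / m²` satisfies `|p|² ≤ |ε|² / m²`. -/
theorem dotProduct_self_normalized_le {Z : Fin n → Idx n → ℝ} {ε : Fin n → ℝ} {N : ℝ}
    (hN : N = 1 + ∑ i, Z i ⬝ᵥ Z i) :
    (N⁻¹ • ∑ i, ε i • Z i) ⬝ᵥ (N⁻¹ • ∑ i, ε i • Z i) ≤ N⁻¹ * ∑ i, ε i ^ 2 := by
  have hZ : 0 ≤ ∑ i, Z i ⬝ᵥ Z i :=
    Finset.sum_nonneg fun i _ => Finset.sum_nonneg fun j _ => mul_self_nonneg _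
  have hNpos : 0 < N := by linarith
  have hε : 0 ≤ ∑ i, ε i ^ 2 := Finset.sum_nonneg fun i _ => sq_nonneg _
  have h : (∑ i, ε i • Z i) ⬝ᵥ (∑ i, ε i • Z i) ≤ (∑ i, ε i ^ 2) * N := by
    calc (∑ i, ε i • Z i) ⬝ᵥ (∑ i, ε i • Z i) = ∑ j, (∑ i, ε i * Z i j) ^ 2 := by
          simp [dotProduct, sq]
      _ ≤ ∑ j, (∑ i, ε i ^ 2) * ∑ i, Z i j ^ 2 :=
          Finset.sum_le_sum fun j _ => Finset.sum_mul_sq_le_sq_mul_sq _ _ _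
      _ = (∑ i, ε i ^ 2) * ∑ i, Z i ⬝ᵥ Z i := by
          rw [← Finset.mul_sum, Finset.sum_comm]
          simp [dotProduct, sq]
      _ ≤ _ := by gcongr; linarith
  rw [smul_dotProduct, dotProduct_smul, smul_eq_mul, smul_eq_mul]
  calc N⁻¹ * (N⁻¹ * ((∑ i, ε i • Z i) ⬝ᵥ (∑ i, ε i • Z i)))
      ≤ N⁻¹ * (N⁻¹ * ((∑ i, ε i ^ 2) * N)) := by gcongr
    _ = _ := by field_simp

/-- One step of the projected adaptive law decreases the Lyapunov function by a multiple of the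
normalized squared estimation error, up to the squared disturbance `η`. -/
theorem lyapunov_step_le {Γ₁ : Matrix (Fin n) (Fin n) ℝ} (hΓ₁ : Γ₁.PosDef) {γ₂ l : ℝ}
    (hγ₂ : 0 < γ₂) (hl2 : l < 2) (hγl : γ₂ ≤ l) (hl : ∀ v, v ⬝ᵥ Γ₁ *ᵥ v ≤ l * (v ⬝ᵥ v))
    {Z : Fin n → Idx n → ℝ} {ε η : Fin n → ℝ} {N : ℝ} (hN : N = 1 + ∑ i, Z i ⬝ᵥ Z i)
    {φ : Idx n → ℝ} (hε : ∀ i, ε i = φ ⬝ᵥ Z i + η i) :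
    lyapunov Γ₁ γ₂ (φ - gain Γ₁ γ₂ *ᵥ (N⁻¹ • ∑ i, ε i • Z i)) +
        (2 - l) / 2 * (N⁻¹ * ∑ i, ε i ^ 2) ≤
      lyapunov Γ₁ γ₂ φ + 2 / (2 - l) * ∑ i, η i ^ 2 := by
  have hZ : 0 ≤ ∑ i, Z i ⬝ᵥ Z i :=
    Finset.sum_nonneg fun i _ => Finset.sum_nonneg fun j _ => mul_self_nonneg _
  have hN1 : N⁻¹ ≤ 1 := inv_le_one_of_one_le₀ (by linarith)
  have hN0 : 0 ≤ N⁻¹ := inv_nonneg.2 (by linarith)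
  have hp := dotProduct_self_normalized_le (ε := ε) hN
  set p := N⁻¹ • ∑ i, ε i • Z i with hpdef
  set E := N⁻¹ * ∑ i, ε i ^ 2 with hE
  rw [lyapunov_sub_gain_mulVec hΓ₁ hγ₂]
  have h1 : fstBlock p ⬝ᵥ Γ₁ *ᵥ fstBlock p + γ₂ * lastEntry p ^ 2 ≤ l * E := by
    have := hl (fstBlock p)
    have h2 : γ₂ * lastEntry p ^ 2 ≤ l * lastEntry p ^ 2 := by gcongr
    have h3 : l * (p ⬝ᵥ p) ≤ l * E := mul_le_mul_of_nonneg_left hp (by linarith)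
    rw [dotProduct_eq_blocks] at h3
    nlinarith
  have h2 : φ ⬝ᵥ p = E - N⁻¹ * ∑ i, ε i * η i := by
    rw [hE, hpdef, dotProduct_smul, dotProduct_sum, smul_eq_mul, ← mul_sub,
      ← Finset.sum_sub_distrib]
    congr 1
    refine Finset.sum_congr rfl fun i _ => ?_
    rw [dotProduct_smul, smul_eq_mul, eq_sub_of_add_eq (hε i).symm]
    ring
  have hc : 0 < 2 - l := by linarith
  -- Young's inequality splits the cross term between the decrease and the disturbance.
  have h3 : 2 * (N⁻¹ * ∑ i, ε i * η i) ≤ (2 - l) / 2 * E + 2 / (2 - l) * ∑ i, η i ^ 2 := by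
    have h4 : 2 * ∑ i, ε i * η i ≤ (2 - l) / 2 * ∑ i, ε i ^ 2 + 2 / (2 - l) * ∑ i, η i ^ 2 := by
      rw [Finset.mul_sum, Finset.mul_sum, Finset.mul_sum, ← Finset.sum_add_distrib]
      refine Finset.sum_le_sum fun i _ => ?_
      have h5 : (2 - l) / 2 * ε i ^ 2 + 2 / (2 - l) * η i ^ 2 - 2 * (ε i * η i) =
          (2 - l) / 2 * (ε i - 2 / (2 - l) * η i) ^ 2 := by
        field_simp
        ring
      have h6 : 0 ≤ (2 - l) / 2 * (ε i - 2 / (2 - l) * η i) ^ 2 := by positivity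
      linarith
    have h7 : 0 ≤ 2 / (2 - l) * ∑ i, η i ^ 2 :=
      mul_nonneg (by positivity) (Finset.sum_nonneg fun i _ => sq_nonneg _)
    calc 2 * (N⁻¹ * ∑ i, ε i * η i) = N⁻¹ * (2 * ∑ i, ε i * η i) := by ring
      _ ≤ N⁻¹ * ((2 - l) / 2 * ∑ i, ε i ^ 2 + 2 / (2 - l) * ∑ i, η i ^ 2) := by gcongr
      _ = (2 - l) / 2 * E + N⁻¹ * (2 / (2 - l) * ∑ i, η i ^ 2) := by rw [hE]; ring
      _ ≤ _ := add_le_add_right (mul_le_of_le_one_left h7 hN1) _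
  linarith

/-- The normalized projected gradient algorithm for the linear error model
`εᵢ = (θ - θs)ᵀ ζᵢ + ηᵢ` with a summable disturbance `η`: the estimates are bounded, the normalized
error vanishes asymptotically, and the adaptation slows down. -/
theorem adaptiveLaw_properties {Γ₁ : Matrix (Fin n) (Fin n) ℝ} (hΓ₁ : Γ₁.PosDef)
    (hΓ₁_lt : ((2 : ℝ) • (1 : Matrix (Fin n) (Fin n) ℝ) - Γ₁).PosDef)
    {γ₂ : ℝ} (hγ₂ : γ₂ ∈ Set.Ioo (0 : ℝ) 2) {s θ₂a : ℝ} (hs : s = 1 ∨ s = -1)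
    {θ g : ℕ → Idx n → ℝ} {θs : Idx n → ℝ} {Z : ℕ → Fin n → Idx n → ℝ} {ε η : ℕ → Fin n → ℝ}
    {N : ℕ → ℝ} (hN : ∀ t, N t = 1 + ∑ i, Z t i ⬝ᵥ Z t i)
    (hε : ∀ t i, ε t i = (θ t - θs) ⬝ᵥ Z t i + η t i) (hη : Summable fun t => ‖η t‖)
    (hg : ∀ t, g t = -((N t)⁻¹ • (gain Γ₁ γ₂ *ᵥ ∑ i, ε t i • Z t i)))
    (hlaw : ∀ t, θ (t + 1) = θ t + g t + Sum.elim (0 : Fin n → ℝ)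
      (fun _ => proj s θ₂a (lastEntry (θ t)) (lastEntry (g t))))
    (hθ : ∀ t, θ₂a ≤ s * lastEntry (θ t)) (hθs : θ₂a ≤ s * lastEntry θs) :
    BoundedSignal θ ∧ Tendsto (fun t => (N t)⁻¹ * ∑ i, ε t i ^ 2) atTop (𝓝 0) ∧
      Tendsto (fun t => θ (t + 1) - θ t) atTop (𝓝 0) := by
  obtain ⟨l', hl'2, hl'⟩ := exists_lt_two_dotProduct_mulVec_le hΓ₁_lt
  set l := max l' γ₂
  have hl2 : l < 2 := max_lt hl'2 hγ₂.2
  have hl (v : Fin n → ℝ) : v ⬝ᵥ Γ₁ *ᵥ v ≤ l * (v ⬝ᵥ v) := (hl' v).trans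
    (mul_le_mul_of_nonneg_right (le_max_left _ _) (Finset.sum_nonneg fun i _ => mul_self_nonneg _))
  have hZ t : 0 ≤ ∑ i, Z t i ⬝ᵥ Z t i :=
    Finset.sum_nonneg fun i _ => Finset.sum_nonneg fun j _ => mul_self_nonneg _
  have hN0 t : 0 ≤ (N t)⁻¹ := inv_nonneg.2 (by linarith [hN t, hZ t])
  have hE0 t : 0 ≤ (N t)⁻¹ * ∑ i, ε t i ^ 2 :=
    mul_nonneg (hN0 t) (Finset.sum_nonneg fun i _ => sq_nonneg _)
  obtain ⟨c, hc, hV⟩ := exists_mul_sq_le_lyapunov hΓ₁ hγ₂.1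
  have hlast t : lastEntry (θ (t + 1)) = lastEntry (θ t) + lastEntry (g t) +
      proj s θ₂a (lastEntry (θ t)) (lastEntry (g t)) := by rw [hlaw t]; rfl
  have hg' t : g t = -(gain Γ₁ γ₂ *ᵥ ((N t)⁻¹ • ∑ i, ε t i • Z t i)) := by
    rw [hg, mulVec_smul]
  have hstep t : lyapunov Γ₁ γ₂ (θ (t + 1) - θs) + (2 - l) / 2 * ((N t)⁻¹ * ∑ i, ε t i ^ 2) ≤
      lyapunov Γ₁ γ₂ (θ t - θs) + 2 / (2 - l) * ∑ i, η t i ^ 2 := by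
    refine le_trans (add_le_add_left ?_ _) (lyapunov_step_le hΓ₁ hγ₂.1 hl2 (le_max_right _ _) hl
      (hN t) (hε t))
    have e : θ t - θs - gain Γ₁ γ₂ *ᵥ ((N t)⁻¹ • ∑ i, ε t i • Z t i) = θ t + g t - θs := by
      rw [hg' t]; abel
    have e1 : fstBlock (θ (t + 1) - θs) = fstBlock (θ t + g t - θs) := by
      ext j; simp [fstBlock, hlaw t]
    have e2 : lastEntry (θ (t + 1) - θs) = lastEntry (θ t) + lastEntry (g t) +
      proj s θ₂a (lastEntry (θ t)) (lastEntry (g t)) - lastEntry θs := by rw [← hlast]; rfl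
    have e3 : lastEntry (θ t + g t - θs) = lastEntry (θ t) + lastEntry (g t) - lastEntry θs := rfl
    rw [e, lyapunov, lyapunov, e1, e2, e3]
    exact add_le_add_right (div_le_div_of_nonneg_right (proj_spec hs (hθ t) hθs).2.2 hγ₂.1.le) _
  have hηs : Summable fun t => 2 / (2 - l) * ∑ i, η t i ^ 2 := by
    refine (summable_sum fun i _ => ?_).mul_left _
    have h1 : Summable fun t => ‖η t‖ ^ 2 := by
      refine Summable.of_norm_bounded_eventually_nat hη ?_
      filter_upwards [hη.tendsto_atTop_zero.eventually_le_const one_pos] with t ht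
      rw [norm_pow, norm_norm, sq]
      exact mul_le_of_le_one_left (norm_nonneg _) ht
    refine Summable.of_nonneg_of_le (fun _ => sq_nonneg _) (fun t => ?_) h1
    rw [← sq_abs]
    exact pow_le_pow_left₀ (abs_nonneg _) (norm_le_pi_norm (η t) i) 2
  have hV0 t : 0 ≤ lyapunov Γ₁ γ₂ (θ t - θs) :=
    le_trans (mul_nonneg hc.le (sq_nonneg _)) (hV _ (Sum.inr ()))
  have h2l : 0 < 2 - l := by linarith
  obtain ⟨⟨C, hC⟩, hEs⟩ := bounded_and_summable_of_add_le hV0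
    (fun t => mul_nonneg (by positivity) (hE0 t))
    (fun t => mul_nonneg (by positivity) (Finset.sum_nonneg fun i _ => sq_nonneg _)) hηs hstep
  have hE : Tendsto (fun t => (N t)⁻¹ * ∑ i, ε t i ^ 2) atTop (𝓝 0) := by
    rw [summable_mul_left_iff (by positivity)] at hEs
    exact hEs.tendsto_atTop_zero
  refine ⟨⟨Real.sqrt (C / c) + ‖θs‖, fun t => ?_⟩, hE, ?_⟩
  · calc ‖θ t‖ = ‖(θ t - θs) + θs‖ := by rw [sub_add_cancel]
      _ ≤ ‖θ t - θs‖ + ‖θs‖ := norm_add_le _ _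
      _ ≤ _ := by
        gcongr
        refine (pi_norm_le_iff_of_nonneg (Real.sqrt_nonneg _)).2 fun j => Real.le_sqrt_of_sq_le ?_
        rw [Real.norm_eq_abs, sq_abs, le_div_iff₀' hc]
        exact (hV _ j).trans (hC t)
  · have hp : Tendsto (fun t => (N t)⁻¹ • ∑ i, ε t i • Z t i) atTop (𝓝 0) := by
      rw [tendsto_zero_iff_norm_tendsto_zero]
      have h := squeeze_zero (fun t => sq_nonneg ‖(N t)⁻¹ • ∑ i, ε t i • Z t i‖)
        (fun t => (norm_sq_le_dotProduct_self _).trans (dotProduct_self_normalized_le (hN t))) hE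
      simpa [Real.sqrt_sq] using h.sqrt
    have hg0 : Tendsto g atTop (𝓝 0) := by
      have hcont : Continuous fun p : Idx n → ℝ => -(gain Γ₁ γ₂ *ᵥ p) :=
        (Continuous.matrix_mulVec continuous_const continuous_id).neg
      have := (hcont.tendsto 0).comp hp
      rw [mulVec_zero, neg_zero] at this
      exact this.congr fun t => (hg' t).symm
    have h2 : Tendsto (fun t => ‖g t‖ + ‖g t‖) atTop (𝓝 0) := by
      simpa using hg0.norm.add hg0.norm
    refine squeeze_zero_norm (fun t => ?_) h2
    rw [hlaw t, add_assoc, add_sub_cancel_left]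
    refine (norm_add_le _ _).trans ?_
    gcongr
    refine (pi_norm_le_iff_of_nonneg (norm_nonneg _)).2 fun j => ?_
    rcases j with j | j
    · simp
    · exact ((proj_spec hs (hθ t) hθs).2.1).trans (norm_le_pi_norm (g t) (Sum.inr ()))

end Stacked

section Signals

variable {n : ℕ} {Am : Matrix (Fin n) (Fin n) ℝ} {bm : Fin n → ℝ}

/-! ### The filters `w_{mi}(z)` -/

theorem Wm_apply (v : ℕ → ℝ) (t : ℕ) (i : Fin n) :
    Wm Am bm v t i = ∑ τ ∈ Finset.range t, v τ * ((Am ^ (t - 1 - τ)) *ᵥ bm) i := by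
  simp [Wm]

theorem Wm_succ (v : ℕ → ℝ) (t : ℕ) :
    Wm Am bm v (t + 1) = Am *ᵥ Wm Am bm v t + v t • bm := by
  rw [Wm, Finset.sum_range_succ, Wm, mulVec_sum]
  congr 1
  · refine Finset.sum_congr rfl fun τ hτ => ?_
    have hτ := Finset.mem_range.1 hτ
    rw [mulVec_smul, mulVec_mulVec, ← pow_succ', show t + 1 - 1 - τ = t - 1 - τ + 1 by omega]
  · simp

/-- Variation of constants. -/
theorem eq_pow_mulVec_add_Wm {y : ℕ → Fin n → ℝ} {v : ℕ → ℝ}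
    (hy : ∀ t, y (t + 1) = Am *ᵥ y t + v t • bm) (t : ℕ) :
    y t = (Am ^ t) *ᵥ y 0 + Wm Am bm v t := by
  induction t with
  | zero => simp [Wm]
  | succ t ih => rw [hy, Wm_succ, ← add_assoc, pow_succ', ← mulVec_mulVec, ← mulVec_add, ← ih]

theorem sum_range_norm_pow_mulVec_le (hs : Summable fun k => ‖(Am ^ k) *ᵥ bm‖) (t : ℕ) :
    ∑ τ ∈ Finset.range t, ‖(Am ^ (t - 1 - τ)) *ᵥ bm‖ ≤ ∑' k, ‖(Am ^ k) *ᵥ bm‖ := by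
  rw [Finset.sum_range_reflect (fun k => ‖(Am ^ k) *ᵥ bm‖) t]
  exact hs.sum_le_tsum _ fun _ _ => norm_nonneg _

theorem norm_Wm_le (hs : Summable fun k => ‖(Am ^ k) *ᵥ bm‖) {v : ℕ → ℝ} {t : ℕ} {M : ℝ}
    (hM : 0 ≤ M) (hv : ∀ τ < t, |v τ| ≤ M) :
    ‖Wm Am bm v t‖ ≤ M * ∑' k, ‖(Am ^ k) *ᵥ bm‖ := by
  calc ‖Wm Am bm v t‖ ≤ ∑ τ ∈ Finset.range t, ‖v τ • ((Am ^ (t - 1 - τ)) *ᵥ bm)‖ :=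
        norm_sum_le _ _
    _ ≤ ∑ τ ∈ Finset.range t, M * ‖(Am ^ (t - 1 - τ)) *ᵥ bm‖ :=
        Finset.sum_le_sum fun τ hτ => by
          rw [norm_smul]
          exact mul_le_mul_of_nonneg_right (hv τ (Finset.mem_range.1 hτ)) (norm_nonneg _)
    _ ≤ _ := by
        rw [← Finset.mul_sum]
        exact mul_le_mul_of_nonneg_left (sum_range_norm_pow_mulVec_le hs t) hM

/-- A Schur stable system with a bounded input has a bounded state. -/
theorem SchurStable.boundedSignal (hAm : SchurStable Am) {y : ℕ → Fin n → ℝ} {v : ℕ → ℝ}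
    (hv : BoundedSignal v) (hy : ∀ t, y (t + 1) = Am *ᵥ y t + v t • bm) : BoundedSignal y := by
  obtain ⟨C, hC⟩ := hv
  have hC0 : 0 ≤ C := (norm_nonneg _).trans (hC 0)
  have hs := hAm.summable_norm_pow_mulVec (y 0)
  refine ⟨∑' k, ‖(Am ^ k) *ᵥ y 0‖ + C * ∑' k, ‖(Am ^ k) *ᵥ bm‖, fun t => ?_⟩
  rw [eq_pow_mulVec_add_Wm hy t]
  exact (norm_add_le _ _).trans (add_le_add (hs.le_tsum t fun _ _ => norm_nonneg _)
    (norm_Wm_le (hAm.summable_norm_pow_mulVec bm) hC0 fun τ _ => hC τ))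

theorem dotProduct_regressor (x : ℕ → Fin n → ℝ) (u : ℕ → ℝ) (c : Idx n → ℝ) (t : ℕ) :
    c ⬝ᵥ regressor x u t = lastEntry c * u t - fstBlock c ⬝ᵥ x t := by
  simp [dotProduct, Fintype.sum_sum_type, regressor, lastEntry, fstBlock]
  ring

theorem dotProduct_zeta (x : ℕ → Fin n → ℝ) (u : ℕ → ℝ) (i : Fin n) (c : Idx n → ℝ) (t : ℕ) :
    c ⬝ᵥ zeta Am bm x u i t = Wm Am bm (fun τ => c ⬝ᵥ regressor x u τ) t i := by
  simp_rw [dotProduct, zeta, Wm_apply, Finset.mul_sum, Finset.sum_mul]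
  rw [Finset.sum_comm]
  simp_rw [mul_assoc]

/-- The swapping term `ξᵢ` in terms of the variation of the estimates over the past. -/
theorem xi_eq (x : ℕ → Fin n → ℝ) (u : ℕ → ℝ) (θ : ℕ → Idx n → ℝ) (i : Fin n) (t : ℕ) :
    xi Am bm x u θ i t = ∑ τ ∈ Finset.range t,
      ((θ t - θ τ) ⬝ᵥ regressor x u τ) * ((Am ^ (t - 1 - τ)) *ᵥ bm) i := by
  simp_rw [xi, dotProduct_zeta, Wm_apply, sub_dotProduct, sub_mul, Finset.sum_sub_distrib]

/-! ### The swapping term for slowly varying parameters -/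

/-- The variation of `θ` over the past, discounted by the impulse response of `W_m`. The truncated
subtraction replaces indices before the initial time by `0`. -/
noncomputable def discountedVariation (Am : Matrix (Fin n) (Fin n) ℝ) (bm : Fin n → ℝ)
    (θ : ℕ → Idx n → ℝ) (t : ℕ) : ℝ :=
  ∑' k, ‖(Am ^ k) *ᵥ bm‖ * ‖θ t - θ (t - 1 - k)‖

theorem discountedVariation_nonneg (θ : ℕ → Idx n → ℝ) (t : ℕ) :
    0 ≤ discountedVariation Am bm θ t :=
  tsum_nonneg fun _ => by positivity

theorem norm_mul_norm_sub_le {θ : ℕ → Idx n → ℝ} {C : ℝ} (hC : ∀ t, ‖θ t‖ ≤ C) (t k : ℕ) :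
    ‖(Am ^ k) *ᵥ bm‖ * ‖θ t - θ (t - 1 - k)‖ ≤ ‖(Am ^ k) *ᵥ bm‖ * (C + C) :=
  mul_le_mul_of_nonneg_left ((norm_sub_le _ _).trans (add_le_add (hC _) (hC _))) (norm_nonneg _)

/-- Dominated convergence for series: for each fixed delay the variation of `θ` tends to zero. -/
theorem tendsto_discountedVariation (hs : Summable fun k => ‖(Am ^ k) *ᵥ bm‖)
    {θ : ℕ → Idx n → ℝ} (hθ : BoundedSignal θ)
    (hdθ : Tendsto (fun t => θ (t + 1) - θ t) atTop (𝓝 0)) :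
    Tendsto (discountedVariation Am bm θ) atTop (𝓝 0) := by
  obtain ⟨C, hC⟩ := hθ
  have hshift : ∀ k, Tendsto (fun t => θ (t + k) - θ t) atTop (𝓝 0) := by
    intro k
    induction k with
    | zero => simp
    | succ k ih =>
      have := ((tendsto_add_atTop_iff_nat k).2 hdθ).add ih
      simp only [sub_add_sub_cancel, add_zero] at this
      exact this
  rw [← tsum_zero (α := ℝ) (β := ℕ)]
  refine tendsto_tsum_of_dominated_convergence (hs.mul_right (C + C)) (fun k => ?_)
    (Eventually.of_forall fun t k => ?_)
  · rw [← tendsto_add_atTop_iff_nat (k + 1)]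
    have := ((hshift (k + 1)).norm.const_mul ‖(Am ^ k) *ᵥ bm‖)
    rw [norm_zero, mul_zero] at this
    refine this.congr fun t => ?_
    rw [show t + (k + 1) - 1 - k = t by omega]
  · rw [Real.norm_of_nonneg (by positivity)]
    exact norm_mul_norm_sub_le hC t k

theorem abs_xi_le (hs : Summable fun k => ‖(Am ^ k) *ᵥ bm‖) {x : ℕ → Fin n → ℝ} {u : ℕ → ℝ}
    {θ : ℕ → Idx n → ℝ} (hθ : BoundedSignal θ) {t : ℕ} {M : ℝ} (hM : 0 ≤ M)
    (hω : ∀ τ < t, ‖regressor x u τ‖ ≤ M) (i : Fin n) :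
    |xi Am bm x u θ i t| ≤ (n + 1) * discountedVariation Am bm θ t * M := by
  obtain ⟨C, hC⟩ := hθ
  have hsum : Summable fun k => ‖(Am ^ k) *ᵥ bm‖ * ‖θ t - θ (t - 1 - k)‖ :=
    Summable.of_nonneg_of_le (fun _ => by positivity) (norm_mul_norm_sub_le hC t)
      (hs.mul_right _)
  rw [xi_eq]
  calc |∑ τ ∈ Finset.range t, ((θ t - θ τ) ⬝ᵥ regressor x u τ) * ((Am ^ (t - 1 - τ)) *ᵥ bm) i|
      ≤ ∑ τ ∈ Finset.range t,
          |((θ t - θ τ) ⬝ᵥ regressor x u τ) * ((Am ^ (t - 1 - τ)) *ᵥ bm) i| :=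
        Finset.abs_sum_le_sum_abs _ _
    _ ≤ ∑ τ ∈ Finset.range t, (n + 1) * M *
          (‖(Am ^ (t - 1 - τ)) *ᵥ bm‖ * ‖θ t - θ (t - 1 - (t - 1 - τ))‖) := by
        refine Finset.sum_le_sum fun τ hτ => ?_
        have hτ := Finset.mem_range.1 hτ
        rw [show t - 1 - (t - 1 - τ) = τ by omega, abs_mul]
        have h1 := abs_dotProduct_le (θ t - θ τ) (regressor x u τ)
        have h2 : |((Am ^ (t - 1 - τ)) *ᵥ bm) i| ≤ ‖(Am ^ (t - 1 - τ)) *ᵥ bm‖ :=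
          norm_le_pi_norm ((Am ^ (t - 1 - τ)) *ᵥ bm) i
        have h3 : (Fintype.card (Idx n) : ℝ) = n + 1 := by simp
        rw [h3] at h1
        calc _ ≤ ((n + 1) * (‖θ t - θ τ‖ * ‖regressor x u τ‖)) * ‖(Am ^ (t - 1 - τ)) *ᵥ bm‖ := by
              gcongr
          _ ≤ ((n + 1) * (‖θ t - θ τ‖ * M)) * ‖(Am ^ (t - 1 - τ)) *ᵥ bm‖ := by
              gcongr
              exact hω τ hτ
          _ = _ := by ring
    _ ≤ (n + 1) * M * discountedVariation Am bm θ t := by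
        rw [← Finset.mul_sum, Finset.sum_range_reflect
          (fun k => ‖(Am ^ k) *ᵥ bm‖ * ‖θ t - θ (t - 1 - k)‖) t]
        exact mul_le_mul_of_nonneg_left (hsum.sum_le_tsum _ fun _ _ => by positivity)
          (by positivity)
    _ = _ := by ring

/-! ### The normalizing signal -/

theorem normalizer_sq (x : ℕ → Fin n → ℝ) (u : ℕ → ℝ) (t : ℕ) :
    normalizer Am bm x u t ^ 2 = 1 + ∑ i, zeta Am bm x u i t ⬝ᵥ zeta Am bm x u i t := by
  refine Real.sq_sqrt ?_
  have : 0 ≤ ∑ i, zeta Am bm x u i t ⬝ᵥ zeta Am bm x u i t :=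
    Finset.sum_nonneg fun i _ => Finset.sum_nonneg fun j _ => mul_self_nonneg _
  linarith

theorem norm_zeta_le (hs : Summable fun k => ‖(Am ^ k) *ᵥ bm‖) {x : ℕ → Fin n → ℝ} {u : ℕ → ℝ}
    {t : ℕ} {M : ℝ} (hM : 0 ≤ M) (hω : ∀ τ < t, ‖regressor x u τ‖ ≤ M) (i : Fin n) :
    ‖zeta Am bm x u i t‖ ≤ M * ∑' k, ‖(Am ^ k) *ᵥ bm‖ := by
  have hS : 0 ≤ ∑' k, ‖(Am ^ k) *ᵥ bm‖ := tsum_nonneg fun _ => norm_nonneg _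
  refine (pi_norm_le_iff_of_nonneg (mul_nonneg hM hS)).2 fun j => ?_
  exact (norm_le_pi_norm (Wm Am bm (fun τ => regressor x u τ j) t) i).trans
    (norm_Wm_le hs hM fun τ hτ => (norm_le_pi_norm _ j).trans (hω τ hτ))

theorem normalizer_le (hs : Summable fun k => ‖(Am ^ k) *ᵥ bm‖) {x : ℕ → Fin n → ℝ} {u : ℕ → ℝ}
    {t : ℕ} {M : ℝ} (hM : 0 ≤ M) (hω : ∀ τ < t, ‖regressor x u τ‖ ≤ M) :
    normalizer Am bm x u t ≤ 1 + (n + 1) * (M * ∑' k, ‖(Am ^ k) *ᵥ bm‖) := by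
  have hS : 0 ≤ ∑' k, ‖(Am ^ k) *ᵥ bm‖ := tsum_nonneg fun _ => norm_nonneg _
  set R := M * ∑' k, ‖(Am ^ k) *ᵥ bm‖ with hR
  have hR0 : 0 ≤ R := mul_nonneg hM hS
  refine Real.sqrt_le_iff.2 ⟨by positivity, ?_⟩
  have h : ∑ i, zeta Am bm x u i t ⬝ᵥ zeta Am bm x u i t ≤ ∑ _i : Fin n, (n + 1) * (R * R) := by
    refine Finset.sum_le_sum fun i _ => ?_
    have h1 := abs_dotProduct_le (zeta Am bm x u i t) (zeta Am bm x u i t)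
    have h3 : (Fintype.card (Idx n) : ℝ) = n + 1 := by simp
    have h2 := norm_zeta_le hs hM hω i
    rw [h3] at h1
    refine (le_abs_self _).trans (h1.trans ?_)
    gcongr
  simp only [Finset.sum_const, Finset.card_univ, Fintype.card_fin, nsmul_eq_mul] at h
  have hn : (0 : ℝ) ≤ n := n.cast_nonneg
  nlinarith [mul_nonneg hn hR0, mul_nonneg hR0 hR0, mul_nonneg hn (mul_nonneg hR0 hR0)]

/-- The estimation error is the normalizing signal times the normalized error. -/
theorem abs_eps_le (x xhat : ℕ → Fin n → ℝ) (u : ℕ → ℝ) (θ : ℕ → Idx n → ℝ) (i : Fin n) (t : ℕ) :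
    |eps Am bm x xhat u θ i t| ≤ Real.sqrt ((normalizer Am bm x u t ^ 2)⁻¹ *
      ∑ i, eps Am bm x xhat u θ i t ^ 2) * normalizer Am bm x u t := by
  have hm0 : 0 ≤ normalizer Am bm x u t := Real.sqrt_nonneg _
  have hm : 0 < normalizer Am bm x u t ^ 2 := by
    have : 0 ≤ ∑ i, zeta Am bm x u i t ⬝ᵥ zeta Am bm x u i t :=
      Finset.sum_nonneg fun i _ => Finset.sum_nonneg fun j _ => mul_self_nonneg _
    rw [normalizer_sq]
    linarith
  have h : Real.sqrt ((normalizer Am bm x u t ^ 2)⁻¹ * ∑ i, eps Am bm x xhat u θ i t ^ 2) *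
      normalizer Am bm x u t = Real.sqrt (∑ i, eps Am bm x xhat u θ i t ^ 2) := by
    nth_rewrite 2 [← Real.sqrt_sq hm0]
    rw [← Real.sqrt_mul' _ hm.le]
    rw [mul_right_comm, inv_mul_cancel₀ hm.ne', one_mul]
  rw [h]
  exact Real.abs_le_sqrt (Finset.single_le_sum (f := fun i => eps Am bm x xhat u θ i t ^ 2)
    (fun _ _ => sq_nonneg _) (Finset.mem_univ i))

/-- The estimator error `x̂ - x` is bounded by an asymptotically vanishing multiple of the past
of the regressor. -/
theorem exists_tendsto_norm_sub_le (hs : Summable fun k => ‖(Am ^ k) *ᵥ bm‖)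
    {x xhat : ℕ → Fin n → ℝ} {u : ℕ → ℝ} {θ : ℕ → Idx n → ℝ} (hθ : BoundedSignal θ)
    (hdθ : Tendsto (fun t => θ (t + 1) - θ t) atTop (𝓝 0))
    (hE : Tendsto (fun t => (normalizer Am bm x u t ^ 2)⁻¹ *
      ∑ i, eps Am bm x xhat u θ i t ^ 2) atTop (𝓝 0)) :
    ∃ ν : ℕ → ℝ, Tendsto ν atTop (𝓝 0) ∧ (∀ t, 0 ≤ ν t) ∧ ∀ t M, 0 ≤ M →
      (∀ τ < t, ‖regressor x u τ‖ ≤ M) → ‖xhat t - x t‖ ≤ ν t * (1 + M) := by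
  set S := ∑' k, ‖(Am ^ k) *ᵥ bm‖ with hSdef
  have hS : 0 ≤ S := tsum_nonneg fun _ => norm_nonneg _
  have hD := discountedVariation_nonneg (Am := Am) (bm := bm) θ
  set μ : ℕ → ℝ := fun t => Real.sqrt ((normalizer Am bm x u t ^ 2)⁻¹ *
      ∑ i, eps Am bm x xhat u θ i t ^ 2) with hμdef
  have hμ0 t : 0 ≤ μ t := Real.sqrt_nonneg _
  have hμ : Tendsto μ atTop (𝓝 0) := by simpa using hE.sqrt
  have hν0 t : 0 ≤ μ t * (1 + (n + 1) * S) + (n + 1) * discountedVariation Am bm θ t := by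
    have := hμ0 t
    have := hD t
    positivity
  refine ⟨fun t => μ t * (1 + (n + 1) * S) + (n + 1) * discountedVariation Am bm θ t, ?_, hν0,
    fun t M hM hω => ?_⟩
  · simpa using (hμ.mul_const (1 + (n + 1) * S)).add
      ((tendsto_discountedVariation hs hθ hdθ).const_mul ((n : ℝ) + 1))
  refine (pi_norm_le_iff_of_nonneg (mul_nonneg (hν0 t) (by linarith))).2 fun i => ?_
  have h1 : (xhat t - x t) i = eps Am bm x xhat u θ i t - xi Am bm x u θ i t := by
    rw [eps, add_sub_cancel_right]
  have h2 := abs_xi_le hs hθ hM hω i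
  have h3 := abs_eps_le (Am := Am) (bm := bm) x xhat u θ i t
  have h4 : μ t * normalizer Am bm x u t ≤ μ t * (1 + (n + 1) * (M * S)) :=
    mul_le_mul_of_nonneg_left (normalizer_le hs hM hω) (hμ0 t)
  have h5 : 0 ≤ μ t * (M + (n + 1) * S) := mul_nonneg (hμ0 t) (by positivity)
  have h6 : 0 ≤ (n + 1) * discountedVariation Am bm θ t := mul_nonneg (by positivity) (hD t)
  rw [h1, Real.norm_eq_abs]
  refine (abs_sub _ _).trans ?_
  linear_combination h2 + h3 + h4 + h5 + h6

end Signals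

/-! ### The closed loop -/

theorem sign_eq_and_le_abs {s a c : ℝ} (hs : s = 1 ∨ s = -1) (ha : 0 < a) (h : a ≤ s * c) :
    Real.sign c = s ∧ a ≤ |c| := by
  rcases hs with rfl | rfl
  · exact ⟨Real.sign_of_pos (by linarith), by linarith [le_abs_self c]⟩
  · exact ⟨Real.sign_of_neg (by linarith), by linarith [neg_le_abs c]⟩

theorem sign_mul_eq_abs (c : ℝ) : Real.sign c * c = |c| := by
  rcases lt_trichotomy c 0 with h | rfl | h
  · rw [Real.sign_of_neg h, abs_of_neg h, neg_one_mul]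
  · simp
  · rw [Real.sign_of_pos h, abs_of_pos h, one_mul]

section Loop

variable {n : ℕ} {A Am : Matrix (Fin n) (Fin n) ℝ} {b bm : Fin n → ℝ} {s θ₂a : ℝ}
  {Γ₁ : Matrix (Fin n) (Fin n) ℝ} {γ₂ : ℝ} {r : ℕ → ℝ} {x xhat xm : ℕ → Fin n → ℝ} {u : ℕ → ℝ}
  {θ : ℕ → Idx n → ℝ}

/-- The true parameter `θ* = [k₁*ᵀ / k₂*, 1 / k₂*]ᵀ`. -/
noncomputable def trueParam (k₁ : Fin n → ℝ) (k₂ : ℝ) : Idx n → ℝ :=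
  Sum.elim (k₂⁻¹ • k₁) (fun _ => k₂⁻¹)

theorem IsIndirectAdaptiveLoop.le_sign_mul_lastEntry
    (hloop : IsIndirectAdaptiveLoop A b Am bm s θ₂a Γ₁ γ₂ r x xhat xm u θ)
    (hs : s = 1 ∨ s = -1) (t : ℕ) : θ₂a ≤ s * lastEntry (θ t) := by
  induction t with
  | zero =>
    rw [← hloop.init_sign, sign_mul_eq_abs]
    exact hloop.init_bound
  | succ t ih => exact hloop.adaptive_law t ▸ (proj_spec hs ih ih).1

/-- The control law makes the parametrized input `θᵀ ω` equal to the reference input. -/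
theorem IsIndirectAdaptiveLoop.dotProduct_regressor_eq
    (hloop : IsIndirectAdaptiveLoop A b Am bm s θ₂a Γ₁ γ₂ r x xhat xm u θ) {t : ℕ}
    (h0 : lastEntry (θ t) ≠ 0) : θ t ⬝ᵥ regressor x u t = r t := by
  rw [dotProduct_regressor, hloop.control, ctrlK₁, ctrlK₂, smul_dotProduct, smul_eq_mul]
  field_simp
  ring

theorem IsIndirectAdaptiveLoop.plant_eq
    (hloop : IsIndirectAdaptiveLoop A b Am bm s θ₂a Γ₁ γ₂ r x xhat xm u θ) {k₁ : Fin n → ℝ}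
    {k₂ : ℝ} (hk₂ : k₂ ≠ 0) (hA : A + vecMulVec b k₁ = Am) (hb : k₂ • b = bm) (t : ℕ) :
    x (t + 1) = Am *ᵥ x t + (trueParam k₁ k₂ ⬝ᵥ regressor x u t) • bm := by
  have h1 : lastEntry (trueParam k₁ k₂) = k₂⁻¹ := rfl
  have h2 : fstBlock (trueParam k₁ k₂) = k₂⁻¹ • k₁ := rfl
  rw [hloop.plant, dotProduct_regressor, h1, h2, ← hA, ← hb, add_mulVec, vecMulVec_mulVec]
  ext i
  simp
  field_simp
  ring

/-- The error model: up to a transient of the stable matrix `A_m`, the estimation errors are linear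
in the parameter error. -/
theorem IsIndirectAdaptiveLoop.eps_eq
    (hloop : IsIndirectAdaptiveLoop A b Am bm s θ₂a Γ₁ γ₂ r x xhat xm u θ) {θs : Idx n → ℝ}
    (hx : ∀ t, x (t + 1) = Am *ᵥ x t + (θs ⬝ᵥ regressor x u t) • bm) (i : Fin n) (t : ℕ) :
    eps Am bm x xhat u θ i t =
      (θ t - θs) ⬝ᵥ zeta Am bm x u i t + ((Am ^ t) *ᵥ (xhat 0 - x 0)) i := by
  have hxhat : ∀ t, xhat (t + 1) = Am *ᵥ xhat t + (θ t ⬝ᵥ regressor x u t) • bm := fun t => by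
    rw [hloop.estimator, dotProduct_regressor]
  rw [eps, xi, sub_dotProduct, dotProduct_zeta x u i θs, mulVec_sub, eq_pow_mulVec_add_Wm hxhat t,
    eq_pow_mulVec_add_Wm hx t]
  simp only [Pi.sub_apply, Pi.add_apply]
  ring

theorem boundedSignal_ctrlK₂ (hθ₂a : 0 < θ₂a) (hθ : ∀ t, θ₂a ≤ |lastEntry (θ t)|) :
    BoundedSignal (ctrlK₂ θ) :=
  ⟨θ₂a⁻¹, fun t => by
    rw [ctrlK₂, norm_inv]
    exact inv_anti₀ hθ₂a (hθ t)⟩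

theorem boundedSignal_ctrlK₁ (hk : BoundedSignal (ctrlK₂ θ)) (hθ : BoundedSignal θ) :
    BoundedSignal (ctrlK₁ θ) := by
  obtain ⟨C, hC⟩ := hk
  obtain ⟨D, hD⟩ := hθ
  refine ⟨C * D, fun t => ?_⟩
  have h : ‖fstBlock (θ t)‖ ≤ ‖θ t‖ :=
    (pi_norm_le_iff_of_nonneg (norm_nonneg _)).2 fun j => norm_le_pi_norm (θ t) (Sum.inl j)
  rw [ctrlK₁, norm_smul]
  exact mul_le_mul (hC t) (h.trans (hD t)) (norm_nonneg _) ((norm_nonneg _).trans (hC t))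

/-- The regressor grows at most linearly with the state. -/
theorem IsIndirectAdaptiveLoop.exists_norm_regressor_le
    (hloop : IsIndirectAdaptiveLoop A b Am bm s θ₂a Γ₁ γ₂ r x xhat xm u θ)
    (h₁ : BoundedSignal (ctrlK₁ θ)) (h₂ : BoundedSignal (ctrlK₂ θ)) (hr : BoundedSignal r) :
    ∃ K, 0 ≤ K ∧ ∀ t, ‖regressor x u t‖ ≤ K * (1 + ‖x t‖) := by
  obtain ⟨C₁, hC₁⟩ := h₁
  obtain ⟨C₂, hC₂⟩ := h₂
  obtain ⟨R, hR⟩ := hr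
  have hC₁0 : 0 ≤ C₁ := (norm_nonneg _).trans (hC₁ 0)
  have hC₂0 : 0 ≤ C₂ := (norm_nonneg _).trans (hC₂ 0)
  have hR0 : 0 ≤ R := (norm_nonneg _).trans (hR 0)
  refine ⟨1 + n * C₁ + C₂ * R, by positivity, fun t => ?_⟩
  have hx0 := norm_nonneg (x t)
  refine (pi_norm_le_iff_of_nonneg (by positivity)).2 fun j => ?_
  have hle : ‖x t‖ ≤ (1 + n * C₁ + C₂ * R) * (1 + ‖x t‖) := by
    have : 0 ≤ (n * C₁ + C₂ * R) * (1 + ‖x t‖) := by positivity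
    linarith
  rcases j with j | j
  · refine le_trans ?_ hle
    simpa [regressor] using norm_le_pi_norm (x t) j
  · change |u t| ≤ _
    rw [hloop.control]
    have e1 := abs_dotProduct_le (ctrlK₁ θ t) (x t)
    rw [Fintype.card_fin] at e1
    have e2 : |ctrlK₂ θ t * r t| ≤ C₂ * R := by
      rw [abs_mul]
      exact mul_le_mul (hC₂ t) (hR t) (abs_nonneg _) hC₂0
    have e3 : n * (‖ctrlK₁ θ t‖ * ‖x t‖) ≤ n * (C₁ * ‖x t‖) := by
      gcongr
      exact hC₁ t
    have e4 : 0 ≤ 1 + ‖x t‖ + n * C₁ + C₂ * R * ‖x t‖ := by positivity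
    refine (abs_add_le _ _).trans ?_
    linear_combination e1 + e2 + e3 + e4

/-- Boundedness of the state: the small gain argument, with `x̂` bounded and `x̂ - x` small relative
to the past of the state. -/
theorem boundedSignal_state {ω : ℕ → Idx n → ℝ} (hxhat : BoundedSignal xhat) {K : ℝ} (hK : 0 ≤ K)
    (hω : ∀ t, ‖ω t‖ ≤ K * (1 + ‖x t‖)) {ν : ℕ → ℝ} (hν : Tendsto ν atTop (𝓝 0))
    (hν0 : ∀ t, 0 ≤ ν t)
    (he : ∀ t M, 0 ≤ M → (∀ τ < t, ‖ω τ‖ ≤ M) → ‖xhat t - x t‖ ≤ ν t * (1 + M)) :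
    BoundedSignal x := by
  obtain ⟨B, hB⟩ := hxhat
  have hν' : Tendsto (fun t => ν t * (1 + K)) atTop (𝓝 0) := by simpa using hν.mul_const (1 + K)
  obtain ⟨C, hC⟩ := exists_le_of_le_add_mul (y := fun t => ‖x t‖) (B := B) hν'
    fun t M hM hx => by
      have h1 := he t (K * (1 + M)) (by positivity) fun τ hτ =>
        (hω τ).trans (mul_le_mul_of_nonneg_left (by linarith [hx τ hτ]) hK)
      have h2 : ‖x t‖ ≤ ‖xhat t‖ + ‖xhat t - x t‖ := by
        calc ‖x t‖ = ‖xhat t - (xhat t - x t)‖ := by rw [sub_sub_cancel]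
          _ ≤ _ := norm_sub_le _ _
      have h3 : ν t * (1 + K * (1 + M)) ≤ ν t * (1 + K) * (1 + M) := by
        have := mul_nonneg (hν0 t) hM
        linear_combination this
      linarith [hB t]
  exact ⟨C, hC⟩

end Loop

end AdaptiveTracking

theorem mainTheorem2 {n : ℕ}
    (A Am : Matrix (Fin n) (Fin n) ℝ) (b bm : Fin n → ℝ)
    (hAm : AdaptiveTracking.SchurStable Am)
    (k₁ : Fin n → ℝ) (k₂ : ℝ) (hk₂ : k₂ ≠ 0)
    (hA : A + Matrix.vecMulVec b k₁ = Am) (hb : k₂ • b = bm)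
    (θ₂a : ℝ) (hθ₂a : 0 < θ₂a) (hθ₂a_le : θ₂a ≤ |1 / k₂|)
    (Γ₁ : Matrix (Fin n) (Fin n) ℝ) (hΓ₁ : Γ₁.PosDef)
    (hΓ₁_lt : ((2 : ℝ) • (1 : Matrix (Fin n) (Fin n) ℝ) - Γ₁).PosDef)
    (γ₂ : ℝ) (hγ₂ : γ₂ ∈ Set.Ioo (0 : ℝ) 2)
    (r : ℕ → ℝ) (hr : AdaptiveTracking.BoundedSignal r)
    (x xhat xm : ℕ → Fin n → ℝ) (u : ℕ → ℝ) (θ : ℕ → AdaptiveTracking.Idx n → ℝ)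
    (hloop : AdaptiveTracking.IsIndirectAdaptiveLoop A b Am bm (Real.sign k₂) θ₂a Γ₁ γ₂ r
      x xhat xm u θ) :
    -- the control law is well defined: the estimate of `1 / k₂` stays away from zero
    (∀ t, Real.sign (AdaptiveTracking.lastEntry (θ t)) = Real.sign k₂ ∧
      θ₂a ≤ |AdaptiveTracking.lastEntry (θ t)|) ∧
    -- all closed-loop signals are bounded
    (AdaptiveTracking.BoundedSignal x ∧
      AdaptiveTracking.BoundedSignal xhat ∧
      AdaptiveTracking.BoundedSignal xm ∧
      AdaptiveTracking.BoundedSignal u ∧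
      AdaptiveTracking.BoundedSignal θ ∧
      AdaptiveTracking.BoundedSignal (AdaptiveTracking.ctrlK₁ θ) ∧
      AdaptiveTracking.BoundedSignal (AdaptiveTracking.ctrlK₂ θ) ∧
      (∀ i, AdaptiveTracking.BoundedSignal (AdaptiveTracking.zeta Am bm x u i)) ∧
      (∀ i, AdaptiveTracking.BoundedSignal (AdaptiveTracking.xi Am bm x u θ i)) ∧
      (∀ i, AdaptiveTracking.BoundedSignal (AdaptiveTracking.eps Am bm x xhat u θ i)) ∧
      AdaptiveTracking.BoundedSignal (AdaptiveTracking.normalizer Am bm x u)) ∧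
    -- asymptotic state tracking
    Tendsto (fun t => x t - xm t) atTop (𝓝 0) ∧
    -- with matching initial states, the estimator state is the reference state
    (xhat 0 = xm 0 → ∀ t, xhat t = xm t) := by
  open AdaptiveTracking in
  have hs : Real.sign k₂ = 1 ∨ Real.sign k₂ = -1 := (Real.sign_apply_eq_of_ne_zero k₂ hk₂).symm
  have hθ₂ := hloop.le_sign_mul_lastEntry hs
  have hsign t := sign_eq_and_le_abs hs hθ₂a (hθ₂ t)
  have hne t : lastEntry (θ t) ≠ 0 := abs_pos.1 (hθ₂a.trans_le (hsign t).2)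
  have hxhat t : xhat (t + 1) = Am *ᵥ xhat t + r t • bm := by
    rw [hloop.estimator, ← dotProduct_regressor, hloop.dotProduct_regressor_eq (hne t)]
  have hx := hloop.plant_eq hk₂ hA hb
  have hsum := hAm.summable_norm_pow_mulVec bm
  have htrue : θ₂a ≤ Real.sign k₂ * lastEntry (trueParam k₁ k₂) := by
    change θ₂a ≤ Real.sign k₂ * k₂⁻¹
    rwa [← Real.sign_inv, sign_mul_eq_abs, ← one_div]
  obtain ⟨hθ, hE, hdθ⟩ := adaptiveLaw_properties hΓ₁ hΓ₁_lt hγ₂ hs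
    (g := increment Am bm Γ₁ γ₂ x xhat u θ) (Z := fun t i => zeta Am bm x u i t)
    (ε := fun t i => eps Am bm x xhat u θ i t) (normalizer_sq x u)
    (fun t i => hloop.eps_eq hx i t) (hAm.summable_norm_pow_mulVec _) (fun _ => rfl)
    hloop.adaptive_law hθ₂ htrue
  have hbk₂ := boundedSignal_ctrlK₂ hθ₂a fun t => (hsign t).2
  have hbk₁ := boundedSignal_ctrlK₁ hbk₂ hθ
  have hbxhat := hAm.boundedSignal hr hxhat
  obtain ⟨ν, hν, hν0, he⟩ := exists_tendsto_norm_sub_le hsum hθ hdθ hE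
  obtain ⟨K, hK, hω⟩ := hloop.exists_norm_regressor_le hbk₁ hbk₂ hr
  have hbx := boundedSignal_state hbxhat hK hω hν hν0 he
  -- With the state bounded, a single bound `M` on the regressor serves for all times.
  obtain ⟨M, hM, hωM⟩ : ∃ M, 0 ≤ M ∧ ∀ t, ‖regressor x u t‖ ≤ M := by
    obtain ⟨C, hC⟩ := hbx
    have hC0 : 0 ≤ C := (norm_nonneg _).trans (hC 0)
    exact ⟨K * (1 + C), by positivity, fun t => (hω t).trans (by gcongr; exact hC t)⟩
  have hbxi i : BoundedSignal (xi Am bm x u θ i) := by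
    obtain ⟨D, hD⟩ := (tendsto_discountedVariation hsum hθ hdθ).bddAbove_range
    refine ⟨(n + 1) * D * M, fun t => (abs_xi_le hsum hθ hM (fun τ _ => hωM τ) i).trans ?_⟩
    gcongr
    exact hD ⟨t, rfl⟩
  have he0 : Tendsto (fun t => xhat t - x t) atTop (𝓝 0) :=
    squeeze_zero_norm (fun t => he t M hM fun τ _ => hωM τ) (by simpa using hν.mul_const (1 + M))
  have hd t : xhat t - xm t = (Am ^ t) *ᵥ (xhat 0 - xm 0) := by
    rw [eq_pow_mulVec_add_Wm hxhat t, eq_pow_mulVec_add_Wm hloop.model t, mulVec_sub]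
    abel
  refine ⟨hsign, ⟨hbx, hbxhat, hAm.boundedSignal hr hloop.model, ⟨M, fun t => ?_⟩, hθ, hbk₁, hbk₂,
    fun i => ⟨_, fun t => norm_zeta_le hsum hM (fun τ _ => hωM τ) i⟩, hbxi, fun i => ?_,
    ?_⟩, ?_, fun h0 t => ?_⟩
  · exact (norm_le_pi_norm (regressor x u t) (Sum.inr ())).trans (hωM t)
  · obtain ⟨B, hB⟩ := hbxhat
    obtain ⟨C, hC⟩ := hbx
    obtain ⟨D, hD⟩ := hbxi i
    refine ⟨B + C + D, fun t => (norm_add_le _ _).trans (add_le_add ?_ (hD t))⟩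
    exact (norm_le_pi_norm (xhat t - x t) i).trans
      ((norm_sub_le _ _).trans (add_le_add (hB t) (hC t)))
  · refine ⟨1 + (n + 1) * (M * ∑' k, ‖(Am ^ k) *ᵥ bm‖), fun t => ?_⟩
    rw [Real.norm_of_nonneg (show 0 ≤ normalizer Am bm x u t from Real.sqrt_nonneg _)]
    exact normalizer_le hsum hM fun τ _ => hωM τ
  · have h := (hAm.summable_norm_pow_mulVec (xhat 0 - xm 0)).tendsto_atTop_zero
    rw [← tendsto_zero_iff_norm_tendsto_zero] at h
    have h2 := (h.congr fun t => (hd t).symm).sub he0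
    rw [sub_zero] at h2
    exact h2.congr fun t => by abel
  · rw [← sub_eq_zero, hd, h0, sub_self, mulVec_zero]
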